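/- Let $r\ge 1$ and let $G$ be an elementary abelian $2$-group of rank $r$, written multiplicatively, with basis $s_1,\dots,s_r$ over $\mathbb F_2$. Let $x_1,\dots,x_r$ be the dual basis of $\mathrm{Hom}(G,\mathbb F_2)=H^1(G,\mathbb F_2)$. Let $G$ act trivially on $\mathbb F_2$; let $C^n(G,\mathbb F_2)$ be the group of normalized cochains, i.e. of functions $a:G^n\to\mathbb F_2$ with $a(u_1,\dots,u_n)=0$ whenever some $u_i=1$, with the usual inhomogeneous coboundary, let $Z^n(G,\mathbb F_2)\subseteq C^n(G,\mathbb F_2)$ be the cocycles and let $H^n(G,\mathbb F_2)$ be the cocycles modulo the coboundaries. Regard $H^*(G,\mathbb F_2)=\bigoplus_{n\ge 0}H^n(G,\mathbb F_2)$ as an $\mathbb F_2$-algebra under the cup product. Then there is an isomorphism of $\mathbb F_2$-algebras $$\tau:\mathbb F_2[x_1,\dots,x_r]\to H^*(G,\mathbb F_2),\qquad x_{i_1}\cdots x_{i_n}\mapsto x_{i_1}\cup\cdots\cup x_{i_n},$$ and its inverse is given, for every $n\ge 0$ and every $a\in Z^n(G,\mathbb F_2)$, by $$\tau^{-1}([a])=\sum_{1\le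 i_1,\dots,i_n\le r}a(s_{i_1},\dots,s_{i_n})\,x_{i_1}\cdots x_{i_n}.$$ -/

import Mathlib

namespace NormalizedCohomology

/-- The group `Cⁿ(G, 𝔽₂)` of normalized (inhomogeneous) `n`-cochains of `G` with values in the
trivial `G`-module `𝔽₂`: the functions `Gⁿ → 𝔽₂` that vanish at `(u₁, …, uₙ)` as soon as some
`uᵢ` is `1`. -/
def Cochain (G : Type*) [Group G] (n : ℕ) : Submodule (ZMod 2) ((Fin n → G) → ZMod 2) where
  carrier := {a | ∀ u : Fin n → G, (∃ i, u i = 1) → a u = 0}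
  add_mem' {a b} ha hb u hu := by simp [ha u hu, hb u hu]
  zero_mem' u _ := rfl
  smul_mem' c a ha u hu := by simp [ha u hu]

theorem mem_cochain {G : Type*} [Group G] {n : ℕ} {a : (Fin n → G) → ZMod 2} :
    a ∈ Cochain G n ↔ ∀ u : Fin n → G, (∃ i, u i = 1) → a u = 0 := Iff.rfl

/-- The inhomogeneous coboundary, for the trivial action of `G` on `𝔽₂`:
`(da)(u₁, …, uₙ₊₁) = a(u₂, …, uₙ₊₁) + ∑_{j=1}^{n} (-1)^j a(u₁, …, uⱼuⱼ₊₁, …, uₙ₊₁)`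
`                     + (-1)^{n+1} a(u₁, …, uₙ)`.
The signs are not written, as `-1 = 1` in `𝔽₂`. For `j < n` (counted from `0`) the tuple
`Fin.contractNth j (· * ·) u` merges the entries `j` and `j + 1` of `u`; for `j = n` it drops the
last entry. -/
def coboundaryFun (G : Type*) [Group G] (n : ℕ) :
    ((Fin n → G) → ZMod 2) →ₗ[ZMod 2] ((Fin (n + 1) → G) → ZMod 2) where
  toFun a u := a (fun i => u i.succ) +
    ∑ j : Fin (n + 1), a (Fin.contractNth j (· * ·) u)
  map_add' a b := by
    funext u
    simp only [Pi.add_apply, Finset.sum_add_distrib]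
    ring
  map_smul' c a := by
    funext u
    simp only [Pi.smul_apply, smul_eq_mul, RingHom.id_apply, mul_add, Finset.mul_sum]

theorem coboundaryFun_apply {G : Type*} [Group G] {n : ℕ} (a : (Fin n → G) → ZMod 2)
    (u : Fin (n + 1) → G) :
    coboundaryFun G n a u = a (fun i => u i.succ) +
      ∑ j : Fin (n + 1), a (Fin.contractNth j (· * ·) u) := rfl

/-- The coboundary of a normalized cochain is normalized. -/
theorem coboundaryFun_mem {G : Type*} [Group G] {n : ℕ} (a : (Fin n → G) → ZMod 2)
    (ha : a ∈ Cochain G n) : coboundaryFun G n a ∈ Cochain G (n + 1) := by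
  rintro u ⟨i, hi⟩
  rw [coboundaryFun_apply]
  have far : ∀ j : Fin (n + 1), (j : ℕ) ≠ i → (j : ℕ) + 1 ≠ i →
      a (Fin.contractNth j (· * ·) u) = 0 := by
    intro j h1 h2
    apply ha
    rcases lt_or_gt_of_ne h1 with h | h
    · have hi0 : (i : ℕ) - 1 < n := by omega
      refine ⟨⟨(i : ℕ) - 1, hi0⟩, ?_⟩
      rw [Fin.contractNth_apply_of_gt _ _ _ _ (by simp only; omega), ← hi]
      congr 1
      ext
      simp only [Fin.val_succ]
      omega
    · refine ⟨⟨(i : ℕ), by omega⟩, ?_⟩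
      rw [Fin.contractNth_apply_of_lt _ _ _ _ (show (i : ℕ) < j from h), ← hi]
      rfl
  obtain rfl | ⟨k, rfl⟩ := i.eq_zero_or_eq_succ
  · rw [Finset.sum_eq_single 0 (fun j _ hj => far j (fun h => hj (Fin.ext h)) (Nat.succ_ne_zero _))
      (fun h => absurd (Finset.mem_univ _) h)]
    have : Fin.contractNth 0 (· * ·) u = fun i => u i.succ := by
      funext t
      by_cases ht : (t : ℕ) = 0
      · have : t.castSucc = 0 := Fin.ext ht
        rw [Fin.contractNth_apply_of_eq _ _ _ _ (by rw [ht]; rfl), this, hi, one_mul]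
      · rw [Fin.contractNth_apply_of_gt _ _ _ _ (Nat.pos_of_ne_zero ht)]
    rw [this, CharTwo.add_self_eq_zero]
  · rw [ha _ ⟨k, hi⟩, zero_add,
      ← Finset.sum_subset (Finset.subset_univ {k.castSucc, k.succ}) (fun j _ hj => far j ?_ ?_),
      Finset.sum_pair (by simp [Fin.ext_iff])]
    · have : Fin.contractNth k.castSucc (· * ·) u = Fin.contractNth k.succ (· * ·) u := by
        funext t
        rcases lt_trichotomy (t : ℕ) k with h | h | h
        · rw [Fin.contractNth_apply_of_lt _ _ _ _ (by simpa using h),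
            Fin.contractNth_apply_of_lt _ _ _ _ (by simp only [Fin.val_succ]; omega)]
        · obtain rfl : t = k := Fin.ext h
          rw [Fin.contractNth_apply_of_eq _ _ _ _ (by simp),
            Fin.contractNth_apply_of_lt _ _ _ _ (by simp), hi, mul_one]
        · rw [Fin.contractNth_apply_of_gt _ _ _ _ (by simpa using h)]
          rcases Nat.eq_or_lt_of_le (Nat.succ_le_of_lt h) with h' | h'
          · have : t.castSucc = k.succ := Fin.ext (by simp; omega)
            rw [Fin.contractNth_apply_of_eq _ _ _ _ (by simp; omega), this, hi, one_mul]
          · rw [Fin.contractNth_apply_of_gt _ _ _ _ (by simp; omega)]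
      rw [this, CharTwo.add_self_eq_zero]
    · intro h
      exact hj (by simp [Fin.ext_iff, h])
    · intro h
      exact hj (by simp [Fin.ext_iff]; left; simpa using h)

/-- The coboundary map `dₙ : Cⁿ(G, 𝔽₂) → Cⁿ⁺¹(G, 𝔽₂)` on normalized cochains. -/
def coboundary (G : Type*) [Group G] (n : ℕ) :
    Cochain G n →ₗ[ZMod 2] Cochain G (n + 1) :=
  (coboundaryFun G n).restrict coboundaryFun_mem

/-- The normalized cocycles `Zⁿ(G, 𝔽₂) = ker dₙ`. -/
def Cocycle (G : Type*) [Group G] (n : ℕ) : Submodule (ZMod 2) (Cochain G n) :=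
  LinearMap.ker (coboundary G n)

/-- The normalized coboundaries: `B⁰(G, 𝔽₂) = 0` and `Bⁿ⁺¹(G, 𝔽₂) = im dₙ`. -/
def Boundary (G : Type*) [Group G] : (n : ℕ) → Submodule (ZMod 2) (Cochain G n)
  | 0 => ⊥
  | n + 1 => LinearMap.range (coboundary G n)

/-- The cohomology group `Hⁿ(G, 𝔽₂) = Zⁿ(G, 𝔽₂) / Bⁿ(G, 𝔽₂)`. -/
def Cohomology (G : Type*) [Group G] (n : ℕ) : Type _ :=
  Cocycle G n ⧸ (Boundary G n).submoduleOf (Cocycle G n)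

instance instAddCommGroup (G : Type*) [Group G] (n : ℕ) : AddCommGroup (Cohomology G n) :=
  inferInstanceAs (AddCommGroup (Cocycle G n ⧸ (Boundary G n).submoduleOf (Cocycle G n)))

instance instModule (G : Type*) [Group G] (n : ℕ) : Module (ZMod 2) (Cohomology G n) :=
  inferInstanceAs (Module (ZMod 2) (Cocycle G n ⧸ (Boundary G n).submoduleOf (Cocycle G n)))

/-- The class `[a] ∈ Hⁿ(G, 𝔽₂)` of a normalized cocycle `a ∈ Zⁿ(G, 𝔽₂)`. -/
def cls {G : Type*} [Group G] {n : ℕ} : Cocycle G n →ₗ[ZMod 2] Cohomology G n :=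
  Submodule.mkQ ((Boundary G n).submoduleOf (Cocycle G n))

theorem mem_cocycle {G : Type*} [Group G] {n : ℕ} {a : Cochain G n} :
    a ∈ Cocycle G n ↔ coboundaryFun G n a.1 = 0 := by
  rw [Cocycle, LinearMap.mem_ker, ← Subtype.coe_inj]
  rfl

/-- `coboundaryFun` is the differential of Mathlib's complex of inhomogeneous cochains of the
trivial representation (after a universe lift of `𝔽₂`). -/
theorem down_d_trivial.{u} {G : Type u} [Group G] (n : ℕ) (a : (Fin n → G) → ULift.{u} (ZMod 2))
    (u : Fin (n + 1) → G) :
    ((inhomogeneousCochains.d (Rep.trivial (ULift.{u} (ZMod 2)) G (ULift.{u} (ZMod 2))) n).hom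
      a u).down = coboundaryFun G n (fun v => (a v).down) u := by
  have hneg : (-1 : ULift.{u} (ZMod 2)) = 1 := ULift.ext _ _ (by decide)
  have h : ∀ (k : ℕ) (c : ULift.{u} (ZMod 2)), (-1 : ULift.{u} (ZMod 2)) ^ k • c = c := by
    intro k c
    rw [hneg, one_pow, one_smul]
  rw [inhomogeneousCochains.d_hom_apply, coboundaryFun_apply]
  refine congrArg (a (fun i => u i.succ)).down.add
    ((map_sum (ULift.ringEquiv.{0, u} (R := ZMod 2)) _ _).trans
      (Finset.sum_congr rfl fun j _ => congrArg ULift.down (h _ _)))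

theorem coboundaryFun_coboundaryFun.{u} {G : Type u} [Group G] (n : ℕ)
    (a : (Fin n → G) → ZMod 2) :
    coboundaryFun G (n + 1) (coboundaryFun G n a) = 0 := by
  funext u
  have h1 := down_d_trivial n (fun v => ULift.up.{u} (a v))
  have h2 := congrArg (fun f => f.hom (fun v => ULift.up.{u} (a v)) u)
    (groupCohomology.inhomogeneousCochains.d_comp_d (n := n)
      (Rep.trivial (ULift.{u} (ZMod 2)) G (ULift.{u} (ZMod 2))))
  have h3 := down_d_trivial (n + 1) ((inhomogeneousCochains.d
    (Rep.trivial (ULift.{u} (ZMod 2)) G (ULift.{u} (ZMod 2))) n).hom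
      (fun v => ULift.up.{u} (a v))) u
  simp only [h1] at h3
  rw [← h3]
  exact congrArg ULift.down h2

/-- `Bⁿ(G, 𝔽₂) ⊆ Zⁿ(G, 𝔽₂)`. -/
theorem boundary_le_cocycle (G : Type*) [Group G] (n : ℕ) : Boundary G n ≤ Cocycle G n := by
  cases n with
  | zero => exact bot_le
  | succ n =>
    rintro _ ⟨c, rfl⟩
    rw [mem_cocycle]
    exact coboundaryFun_coboundaryFun n c.1

theorem eq_zero_or_of_mem_boundary {G : Type*} [Group G] {n : ℕ} {a : Cochain G n}
    (ha : a ∈ Boundary G n) : a = 0 ∨ ∃ (m : ℕ) (h : m + 1 = n) (c : (Fin m → G) → ZMod 2),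
      c ∈ Cochain G m ∧ ∀ u, a.1 u = coboundaryFun G m c (fun i => u (Fin.cast h i)) := by
  cases n with
  | zero => exact Or.inl ha
  | succ n =>
    obtain ⟨c, rfl⟩ := ha
    exact Or.inr ⟨n, rfl, c.1, c.2, fun u => rfl⟩

theorem mem_boundary_of_eq {G : Type*} [Group G] {n : ℕ} {a : Cochain G n} (m : ℕ)
    (h : m + 1 = n) (c : (Fin m → G) → ZMod 2) (hc : c ∈ Cochain G m)
    (H : ∀ u, a.1 u = coboundaryFun G m c (fun i => u (Fin.cast h i))) : a ∈ Boundary G n := by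
  subst h
  exact ⟨⟨c, hc⟩, Subtype.ext (funext fun u => (H u).symm)⟩

/-- The cup product of cochains, `(a ∪ b)(u₁, …, uₘ₊ₙ) = a(u₁, …, uₘ) b(uₘ₊₁, …, uₘ₊ₙ)`.
(The action on the coefficients is trivial, and a sign `(-1)^{mn}` is `1` in `𝔽₂`.) -/
def cupFun {G : Type*} {m n : ℕ} (a : (Fin m → G) → ZMod 2) (b : (Fin n → G) → ZMod 2) :
    (Fin (m + n) → G) → ZMod 2 :=
  fun u => a (fun i => u (Fin.castAdd n i)) * b (fun j => u (Fin.natAdd m j))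

theorem cupFun_mem {G : Type*} [Group G] {m n : ℕ} {a : (Fin m → G) → ZMod 2}
    {b : (Fin n → G) → ZMod 2} (ha : a ∈ Cochain G m) (hb : b ∈ Cochain G n) :
    cupFun a b ∈ Cochain G (m + n) := by
  rintro u ⟨i, hi⟩
  unfold cupFun
  induction i using Fin.addCases with
  | left i => rw [ha _ ⟨i, hi⟩, zero_mul]
  | right i => rw [hb _ ⟨i, hi⟩, mul_zero]

/-- The Leibniz rule `d(a ∪ b) = da ∪ b + a ∪ db`. -/
theorem coboundaryFun_cupFun {G : Type*} [Group G] {m n : ℕ} (a : (Fin m → G) → ZMod 2)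
    (b : (Fin n → G) → ZMod 2) (u : Fin (m + n + 1) → G) :
    coboundaryFun G (m + n) (cupFun a b) u =
      cupFun (coboundaryFun G m a) b (fun i => u (Fin.cast (by omega) i)) +
        cupFun a (coboundaryFun G n b) u := by
  have e : m + (n + 1) = m + n + 1 := rfl
  have hsum : ∑ j : Fin (m + n + 1), cupFun a b (Fin.contractNth j (· * ·) u) =
      (∑ j : Fin m, cupFun a b (Fin.contractNth (Fin.castAdd (n + 1) j) (· * ·) u)) +
      ∑ j : Fin (n + 1), cupFun a b (Fin.contractNth (Fin.natAdd m j) (· * ·) u) :=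
    Fin.sum_univ_add (a := m) (b := n + 1) (fun j => cupFun a b (Fin.contractNth j (· * ·) u))
  have h1 : ∀ j : Fin m, cupFun a b (Fin.contractNth (Fin.castAdd (n + 1) j) (· * ·) u) =
      a (Fin.contractNth j.castSucc (· * ·) fun i : Fin (m + 1) => u ⟨i, by omega⟩) *
        b (fun i => u ⟨m + 1 + i, by omega⟩) := by
    intro j
    unfold cupFun
    refine congrArg₂ (· * ·) (congrArg a (funext fun t => ?_)) (congrArg b (funext fun t => ?_))
    · simp [Fin.contractNth, Fin.succ, Fin.castSucc, Fin.castAdd, Fin.castLE]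
    · simp only [Fin.contractNth, Fin.val_natAdd, Fin.val_castAdd]
      rw [if_neg (by omega), if_neg (by omega)]
      exact congrArg u (Fin.ext (by simp only [Fin.val_succ, Fin.val_natAdd]; omega))
  have h2 : ∀ j : Fin (n + 1), cupFun a b (Fin.contractNth (Fin.natAdd m j) (· * ·) u) =
      a (fun i : Fin m => u ⟨i, by omega⟩) *
        b (Fin.contractNth j (· * ·) fun i : Fin (n + 1) => u ⟨m + i, by omega⟩) := by
    intro j
    unfold cupFun
    congr 2 <;> funext t
    · simp only [Fin.contractNth, Fin.val_natAdd, Fin.val_castAdd]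
      rw [if_pos (by omega)]
      rfl
    · simp [Fin.contractNth, Fin.succ, Fin.castSucc, Fin.castAdd, Fin.castLE, add_assoc]
  have h3 : Fin.contractNth (Fin.last m) (· * ·) (fun i : Fin (m + 1) => u ⟨i, by omega⟩) =
      fun i : Fin m => u ⟨i, by omega⟩ := by
    funext t
    rw [Fin.contractNth_apply_of_lt _ _ _ _ (by simp)]
    rfl
  have h4 : cupFun a b (fun i => u i.succ) =
      a (fun i : Fin m => u ⟨i + 1, by omega⟩) * b (fun i => u ⟨m + 1 + i, by omega⟩) := by
    unfold cupFun
    congr 2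
    funext t
    exact congrArg u (Fin.ext (by simp only [Fin.val_succ, Fin.val_natAdd]; omega))
  have h5 : cupFun (coboundaryFun G m a) b (fun i => u (Fin.cast (by omega) i)) =
      (a (fun i : Fin m => u ⟨i + 1, by omega⟩) +
        ∑ j : Fin (m + 1), a (Fin.contractNth j (· * ·) fun i : Fin (m + 1) => u ⟨i, by omega⟩)) *
      b (fun i => u ⟨m + 1 + i, by omega⟩) := rfl
  have h6 : cupFun a (coboundaryFun G n b) u =
      a (fun i : Fin m => u ⟨i, by omega⟩) * (b (fun i => u ⟨m + (i + 1), by omega⟩) +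
        ∑ j : Fin (n + 1), b (Fin.contractNth j (· * ·)
          fun i : Fin (n + 1) => u ⟨m + i, by omega⟩)) := rfl
  have h7 : b (fun i => u ⟨m + (i + 1), by omega⟩) = b (fun i => u ⟨m + 1 + i, by omega⟩) := by
    congr 1
    funext t
    congr 2
    omega
  rw [coboundaryFun_apply, hsum, h4, h5, h6, h7]
  simp only [h1, h2, ← Finset.sum_mul, ← Finset.mul_sum]
  rw [Fin.sum_univ_castSucc (n := m), h3]
  linear_combination (-1 : ZMod 2) * CharTwo.add_self_eq_zero
    (a (fun i : Fin m => u ⟨i, by omega⟩) * b (fun i => u ⟨m + 1 + i, by omega⟩))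

/-- The cup product of normalized cocycles. -/
def cupCocycle {G : Type*} [Group G] {m n : ℕ} (a : Cocycle G m) (b : Cocycle G n) :
    Cocycle G (m + n) :=
  ⟨⟨cupFun a.1.1 b.1.1, cupFun_mem a.1.2 b.1.2⟩, by
    rw [mem_cocycle]
    funext u
    rw [coboundaryFun_cupFun, mem_cocycle.1 a.2, mem_cocycle.1 b.2]
    simp [cupFun]⟩

theorem cls_eq_zero {G : Type*} [Group G] {n : ℕ} {a : Cocycle G n} :
    cls a = 0 ↔ a.1 ∈ Boundary G n := by
  exact Submodule.Quotient.mk_eq_zero ((Boundary G n).submoduleOf (Cocycle G n))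

theorem cls_surjective {G : Type*} [Group G] {n : ℕ} :
    Function.Surjective (cls : Cocycle G n → Cohomology G n) :=
  Submodule.mkQ_surjective ((Boundary G n).submoduleOf (Cocycle G n))

theorem cls_cupCocycle_left {G : Type*} [Group G] {m n : ℕ} (a : Cocycle G m) (b : Cocycle G n)
    (ha : a.1 ∈ Boundary G m) : cls (cupCocycle a b) = 0 := by
  rw [cls_eq_zero]
  rcases eq_zero_or_of_mem_boundary ha with h | ⟨k, rfl, c, hc, H⟩
  · convert (Boundary G (m + n)).zero_mem using 1
    ext u
    simp [cupCocycle, cupFun, h]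
  · refine mem_boundary_of_eq (k + n) (by omega) (cupFun c b.1.1) (cupFun_mem hc b.1.2) fun u => ?_
    rw [coboundaryFun_cupFun, mem_cocycle.1 b.2]
    simp only [cupCocycle, cupFun, Pi.zero_apply, mul_zero, add_zero, H]
    rfl

theorem cls_cupCocycle_right {G : Type*} [Group G] {m n : ℕ} (a : Cocycle G m) (b : Cocycle G n)
    (hb : b.1 ∈ Boundary G n) : cls (cupCocycle a b) = 0 := by
  rw [cls_eq_zero]
  rcases eq_zero_or_of_mem_boundary hb with h | ⟨k, rfl, c, hc, H⟩
  · convert (Boundary G (m + n)).zero_mem using 1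
    ext u
    simp [cupCocycle, cupFun, h]
  · refine mem_boundary_of_eq (m + k) (by omega) (cupFun a.1.1 c) (cupFun_mem a.1.2 hc) fun u => ?_
    rw [coboundaryFun_cupFun, mem_cocycle.1 a.2]
    simp only [cupCocycle, cupFun, Pi.zero_apply, zero_mul, zero_add, H]
    rfl

/-- The bilinear map `(a, b) ↦ [a ∪ b]` on cocycles. -/
def cupCls (G : Type*) [Group G] (m n : ℕ) :
    Cocycle G m →ₗ[ZMod 2] Cocycle G n →ₗ[ZMod 2] Cohomology G (m + n) :=
  LinearMap.mk₂ (ZMod 2) (fun a b => cls (cupCocycle a b))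
    (fun a a' b => by
      rw [← map_add]
      refine congrArg cls (Subtype.ext (Subtype.ext (funext fun u => ?_)))
      exact add_mul _ _ _)
    (fun c a b => by
      rw [← map_smul]
      refine congrArg cls (Subtype.ext (Subtype.ext (funext fun u => ?_)))
      exact mul_assoc _ _ _)
    (fun a b b' => by
      rw [← map_add]
      refine congrArg cls (Subtype.ext (Subtype.ext (funext fun u => ?_)))
      exact mul_add _ _ _)
    (fun c a b => by
      rw [← map_smul]
      refine congrArg cls (Subtype.ext (Subtype.ext (funext fun u => ?_)))
      exact mul_left_comm _ _ _)

/-- The cup product `∪ : Hᵐ(G, 𝔽₂) × Hⁿ(G, 𝔽₂) → Hᵐ⁺ⁿ(G, 𝔽₂)`, `[a] ∪ [b] = [a ∪ b]`. -/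
def cup {G : Type*} [Group G] {m n : ℕ} :
    Cohomology G m →ₗ[ZMod 2] Cohomology G n →ₗ[ZMod 2] Cohomology G (m + n) :=
  (cupCls G m n).liftQ₂ ((Boundary G m).submoduleOf (Cocycle G m))
    ((Boundary G n).submoduleOf (Cocycle G n))
    (fun a ha => LinearMap.ext fun b => cls_cupCocycle_left a b ha)
    (fun b hb => LinearMap.ext fun a => cls_cupCocycle_right a b hb)

theorem cup_cls {G : Type*} [Group G] {m n : ℕ} (a : Cocycle G m) (b : Cocycle G n) :
    cup (cls a) (cls b) = cls (cupCocycle a b) := rfl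

/-- The constant `c ∈ 𝔽₂` as a normalized cocycle of degree `0`. -/
def constCocycle (G : Type*) [Group G] : ZMod 2 →ₗ[ZMod 2] Cocycle G 0 where
  toFun c := ⟨⟨fun _ => c, fun _ ⟨i, _⟩ => i.elim0⟩, by
    rw [mem_cocycle]
    funext u
    simp [coboundaryFun_apply, CharTwo.add_self_eq_zero]⟩
  map_add' _ _ := rfl
  map_smul' _ _ := rfl

theorem mk_cls_eq {G : Type*} [Group G] {m n : ℕ} (h : m = n) (a : Cocycle G m) (b : Cocycle G n)
    (H : ∀ u : Fin n → G, a.1.1 (fun i => u (Fin.cast h i)) = b.1.1 u) :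
    (GradedMonoid.mk m (cls a) : GradedMonoid (Cohomology G)) = GradedMonoid.mk n (cls b) := by
  subst h
  congr 2
  ext u
  exact H u

instance instGMul (G : Type*) [Group G] : GradedMonoid.GMul (Cohomology G) where
  mul a b := cup a b

instance instGOne (G : Type*) [Group G] : GradedMonoid.GOne (Cohomology G) where
  one := cls (constCocycle G 1)

/-- The cup product makes `H*(G, 𝔽₂) = ⨁ₙ Hⁿ(G, 𝔽₂)` a graded ring, with unit the class of the
constant `0`-cochain `1`. -/
instance instGSemiring (G : Type*) [Group G] : DirectSum.GSemiring (Cohomology G) where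
  mul_zero a := map_zero (cup a)
  zero_mul b := by
    change cup 0 b = 0
    rw [map_zero, LinearMap.zero_apply]
  mul_add a b c := map_add (cup a) b c
  add_mul a b c := by
    change cup (a + b) c = cup a c + cup b c
    rw [map_add, LinearMap.add_apply]
  one_mul := by
    rintro ⟨n, x⟩
    obtain ⟨a, rfl⟩ := cls_surjective x
    refine mk_cls_eq (zero_add n) (cupCocycle (constCocycle G 1) a) a fun u => ?_
    simp only [cupCocycle, cupFun, constCocycle, LinearMap.coe_mk, AddHom.coe_mk, one_mul]
    exact congrArg a.1.1 (funext fun i => congrArg u (Fin.ext (by simp)))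
  mul_one := by
    rintro ⟨n, x⟩
    obtain ⟨a, rfl⟩ := cls_surjective x
    refine mk_cls_eq (add_zero n) (cupCocycle a (constCocycle G 1)) a fun u => ?_
    simp only [cupCocycle, cupFun, constCocycle, LinearMap.coe_mk, AddHom.coe_mk, mul_one]
    rfl
  mul_assoc := by
    rintro ⟨l, x⟩ ⟨m, y⟩ ⟨n, z⟩
    obtain ⟨a, rfl⟩ := cls_surjective x
    obtain ⟨b, rfl⟩ := cls_surjective y
    obtain ⟨c, rfl⟩ := cls_surjective z
    refine mk_cls_eq (add_assoc l m n) (cupCocycle (cupCocycle a b) c)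
      (cupCocycle a (cupCocycle b c)) fun u => ?_
    simp only [cupCocycle, cupFun, mul_assoc]
    exact congrArg (a.1.1 _ * ·) (congrArg (b.1.1 _ * ·) (congrArg c.1.1
      (funext fun i => congrArg u (Fin.ext (by simp [add_assoc])))))
  natCast k := cls (constCocycle G k)
  natCast_zero := by rw [Nat.cast_zero, map_zero, map_zero]
  natCast_succ k := by
    rw [Nat.cast_succ, map_add, map_add]
    rfl

/-- `H*(G, 𝔽₂)` is a graded `𝔽₂`-algebra, with structure map `𝔽₂ → H⁰(G, 𝔽₂)`. -/
instance instGAlgebra (G : Type*) [Group G] : DirectSum.GAlgebra (ZMod 2) (Cohomology G) where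
  toFun := (cls ∘ₗ constCocycle G).toAddMonoidHom
  map_one := rfl
  map_mul r s := by
    refine mk_cls_eq rfl (constCocycle G (r * s))
      (cupCocycle (constCocycle G r) (constCocycle G s)) fun u => ?_
    rfl
  commutes r := by
    rintro ⟨n, x⟩
    obtain ⟨a, rfl⟩ := cls_surjective x
    refine mk_cls_eq ((zero_add n).trans (add_zero n).symm) (cupCocycle (constCocycle G r) a)
      (cupCocycle a (constCocycle G r)) fun u => ?_
    simp only [cupCocycle, cupFun, constCocycle, LinearMap.coe_mk, AddHom.coe_mk]
    rw [mul_comm]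
    exact congrArg (· * r) (congrArg a.1.1 (funext fun i => congrArg u (Fin.ext (by simp))))
  smul_def r := by
    rintro ⟨n, x⟩
    obtain ⟨a, rfl⟩ := cls_surjective x
    refine mk_cls_eq (zero_add n).symm (r • a) (cupCocycle (constCocycle G r) a) fun u => ?_
    simp only [cupCocycle, cupFun, constCocycle, LinearMap.coe_mk, AddHom.coe_mk,
      Submodule.coe_smul, Pi.smul_apply, smul_eq_mul]
    exact congrArg (r * ·) (congrArg a.1.1 (funext fun i => congrArg u (Fin.ext (by simp))))

/-- The cohomology algebra `H*(G, 𝔽₂) = ⨁ₙ Hⁿ(G, 𝔽₂)`, an `𝔽₂`-algebra under the cup product. -/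
abbrev CohomologyAlgebra (G : Type*) [Group G] : Type _ :=
  DirectSum ℕ (Cohomology G)

/-- The class `[a]` of a cocycle `a ∈ Zⁿ(G, 𝔽₂)`, seen in `H*(G, 𝔽₂)`. -/
def totalClass {G : Type*} [Group G] {n : ℕ} (a : Cocycle G n) : CohomologyAlgebra G :=
  DirectSum.of (Cohomology G) n (cls a)

/-- A homomorphism `f : G → 𝔽₂` as a normalized cocycle of degree `1`; this is the identification
of `Hom(G, 𝔽₂)` with `H¹(G, 𝔽₂)`. -/
def homCocycle {G : Type*} [Group G] (f : Additive G →+ ZMod 2) : Cocycle G 1 :=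
  ⟨⟨fun u => f (Additive.ofMul (u 0)), fun u ⟨i, hi⟩ => by
    obtain rfl : i = 0 := Subsingleton.elim _ _
    change f (Additive.ofMul (u 0)) = 0
    rw [hi, ofMul_one, map_zero]⟩, by
    rw [mem_cocycle]
    funext u
    simp [coboundaryFun_apply, Fin.contractNth]
    linear_combination CharTwo.add_self_eq_zero (f (Additive.ofMul (u 0))) +
      CharTwo.add_self_eq_zero (f (Additive.ofMul (u 1)))⟩

end NormalizedCohomology

/-! Evaluating cochains at the basis elements gives `evalPoly`, which turns cup products into
products of polynomials (`evalPoly_cupFun`). It kills coboundaries of normalized cochains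
(`genPoly_listCoboundary`): terms containing `s i * s j` cancel in pairs by commutativity, the
diagonal ones vanish because `s i * s i = 1`, and the two outer faces give the same polynomial
because the variables commute. The result is a graded algebra homomorphism `polyAlgHom` from
cohomology to polynomials. It is surjective because the class of the coordinate `i` goes to `X i`.

Injectivity (`exists_eq_listCoboundary_of_genPoly_eq_zero`) is a double induction on the rank and
the degree. Let `a` be a cocycle with zero polynomial, and let `H` be the kernel of the character `χ
0`. The polynomial of the restriction of `a` to `H` arises by setting the first variable to 0, so by
induction on the rank this restriction is a coboundary. After correcting `a` by a coboundary, it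
vanishes on `H`. Then `exists_eq_character_mul_add_listCoboundary` gives `a = χ 0 ∪ b + de` with `b`
a cocycle of one degree less. Hence `X 0` times the polynomial of `b` is 0, the polynomial of `b` is
0, and by induction on the degree `b = dk`. So `χ 0 ∪ b = d(χ 0 ∪ k)`, using `-1 = 1`.

The splitting comes from the prism homotopy between the identity and a retraction of `G` onto `H`.
Cochains are treated as functions on lists, so that faces and homotopies become recursions on head
and tail. -/

namespace NormalizedCohomology

/-! ### Homogeneous cochains and the prism homotopy. -/

section ListCochain

variable {G : Type*}

/-- The differential on homogeneous cochains: the sum over all ways to omit one entry. -/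
def omitSum : (List G → ZMod 2) → List G → ZMod 2
  | _, [] => 0
  | A, x :: l => A l + omitSum (fun t => A (x :: t)) l

/-- The prism operator between the identity and the map of lists induced by `ρ`. -/
def prism (ρ : G → G) : (List G → ZMod 2) → List G → ZMod 2
  | _, [] => 0
  | A, x :: l => A (x :: ρ x :: l.map ρ) + prism ρ (fun t => A (x :: t)) l

theorem omitSum_add (A B : List G → ZMod 2) (l : List G) :
    omitSum (fun t => A t + B t) l = omitSum A l + omitSum B l := by
  induction l generalizing A B with
  | nil => simp [omitSum]
  | cons x l ih => simp only [omitSum, ih]; ring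

theorem prism_add (ρ : G → G) (A B : List G → ZMod 2) (l : List G) :
    prism ρ (fun t => A t + B t) l = prism ρ A l + prism ρ B l := by
  induction l generalizing A B with
  | nil => simp [prism]
  | cons x l ih => simp only [prism, ih]; ring

theorem omitSum_comp_map (ρ : G → G) (A : List G → ZMod 2) (l : List G) :
    omitSum (fun t => A (t.map ρ)) l = omitSum A (l.map ρ) := by
  induction l generalizing A with
  | nil => simp [omitSum]
  | cons x l ih =>
    simp only [omitSum, List.map_cons]
    rw [ih fun t => A (ρ x :: t)]

/-- With head `x`, the two ways to omit `x` and one further entry both contribute `omitSum A l` and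
cancel modulo 2; the induction hypothesis handles the terms that keep `x`. -/
theorem omitSum_omitSum (A : List G → ZMod 2) (l : List G) : omitSum (omitSum A) l = 0 := by
  induction l generalizing A with
  | nil => rfl
  | cons x l ih =>
    have h := omitSum_add A (omitSum fun t => A (x :: t)) l
    rw [ih, add_zero] at h
    rw [omitSum]
    exact (congrArg _ h).trans (CharTwo.add_self_eq_zero _)

/-- Applied with `σ` a left translation, this shows that the prism operator preserves invariance
under the translations that commute with `ρ`. -/
theorem prism_comp_map {ρ σ : G → G} (h : ∀ x, σ (ρ x) = ρ (σ x)) (A : List G → ZMod 2)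
    (l : List G) : prism ρ (fun t => A (t.map σ)) l = prism ρ A (l.map σ) := by
  induction l generalizing A with
  | nil => simp [prism]
  | cons x l ih =>
    simp only [prism, List.map_cons, List.map_map]
    rw [ih fun t => A (σ x :: t), h, show σ ∘ ρ = ρ ∘ σ from funext h]

theorem prism_eq_zero {ρ : G → G} {n : ℕ} {A : List G → ZMod 2}
    (hA : ∀ l, l.length = n + 1 → A l = 0) (l : List G) (hl : l.length = n) :
    prism ρ A l = 0 := by
  induction l generalizing A n with
  | nil => rfl
  | cons x l ih =>
    subst hl
    rw [prism, hA _ (by simp), ih (fun t ht => hA _ (by simpa using ht)) rfl, add_zero]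

/-- The prism operator is a homotopy between the identity and `ρ`. -/
theorem omitSum_prism_add_prism_omitSum (ρ : G → G) (A : List G → ZMod 2) (l : List G) :
    omitSum (prism ρ A) l + prism ρ (omitSum A) l = A l + A (l.map ρ) := by
  induction l generalizing A with
  | nil => simp [omitSum, prism, CharTwo.add_self_eq_zero]
  | cons x l ih =>
    have h := ih fun t => A (x :: t)
    have h1 := omitSum_comp_map ρ (fun t => A (x :: ρ x :: t)) l
    simp only [omitSum, prism, List.map_cons, omitSum_add, prism_add] at h h1 ⊢
    rw [h1]
    linear_combination h + CharTwo.add_self_eq_zero (prism ρ A l) +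
      CharTwo.add_self_eq_zero (A (x :: l.map ρ)) + CharTwo.add_self_eq_zero
        (omitSum (fun t => A (x :: ρ x :: t)) (l.map ρ))

/-- In homogeneous form, normalized means vanishing at lists with equal neighbours. Each prism term
is `x₀, …, xₖ, ρ xₖ, …, ρ xₙ`, and an equal pair of neighbours survives in it, either unchanged or
as its image under `ρ`. -/
theorem prism_eq_zero_of_not_isChain {ρ : G → G} {A : List G → ZMod 2}
    (hA : ∀ l, ¬ l.IsChain (· ≠ ·) → A l = 0) (l : List G) (hl : ¬ l.IsChain (· ≠ ·)) :
    prism ρ A l = 0 := by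
  induction l generalizing A with
  | nil => rfl
  | cons x l ih =>
    have hx : ∀ t, ¬ t.IsChain (· ≠ ·) → A (x :: t) = 0 := fun t ht => hA _ fun h => ht h.tail
    cases l with
    | nil => simp at hl
    | cons y l =>
      rw [List.isChain_cons_cons, not_and_or, not_not] at hl
      by_cases h : (y :: l).IsChain (· ≠ ·)
      · obtain rfl : x = y := hl.resolve_right (not_not.2 h)
        have h0 : ∀ t, A (x :: x :: t) = 0 := fun t => hA _ (by simp)
        have h1 : prism ρ (fun t => A (x :: x :: t)) l = 0 :=
          prism_eq_zero (n := l.length) (fun t _ => h0 t) l rfl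
        rw [prism, prism, h0, h1, hA _ (by simp)]
        simp
      · rw [prism, ih hx h, add_zero]
        refine hA _ fun hc => h ?_
        have h1 := hc.tail.tail
        simp only [List.tail_cons] at h1
        exact (List.isChain_map ρ).1 h1 |>.imp fun a b hab he => hab (congrArg ρ he)

/-! ### Inhomogeneous cochains on lists and their translation into homogeneous ones. -/

variable [Group G]

/-- The sum of the values of a cochain at the lists obtained by multiplying two neighbours,
or by dropping the last entry. -/
def mergeSum : (List G → ZMod 2) → List G → ZMod 2
  | _, [] => 0
  | a, [_] => a []
  | a, u :: v :: l => a (u * v :: l) + mergeSum (fun t => a (u :: t)) (v :: l)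

/-- The inhomogeneous coboundary on functions of lists. -/
def listCoboundary (a : List G → ZMod 2) : List G → ZMod 2
  | [] => 0
  | u :: l => a l + mergeSum a (u :: l)

/-- The lists `[g, g u₁, g u₁ u₂, …]` of partial products. -/
def partialProds : G → List G → List G
  | g, [] => [g]
  | g, u :: l => g :: partialProds (g * u) l

/-- The lists `[g₁⁻¹ g₂, g₂⁻¹ g₃, …]` of successive quotients. -/
def quotients : List G → List G
  | [] => []
  | [_] => []
  | g :: h :: l => g⁻¹ * h :: quotients (h :: l)

/-- A function on lists is normalized if it vanishes at the lists that contain `1`. -/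
def IsNormalized (a : List G → ZMod 2) : Prop := ∀ l, 1 ∈ l → a l = 0

theorem IsNormalized.cons {a : List G → ZMod 2} (ha : IsNormalized a) (u : G) :
    IsNormalized fun t => a (u :: t) := fun l hl => ha _ (by simp [hl])

theorem IsNormalized.add {a b : List G → ZMod 2} (ha : IsNormalized a) (hb : IsNormalized b) :
    IsNormalized fun t => a t + b t := fun l hl => by simp [ha l hl, hb l hl]

theorem mergeSum_add (a b : List G → ZMod 2) (l : List G) :
    mergeSum (fun t => a t + b t) l = mergeSum a l + mergeSum b l := by
  induction l generalizing a b with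
  | nil => simp [mergeSum]
  | cons u l ih =>
    cases l with
    | nil => rfl
    | cons v l => simp only [mergeSum, ih]; ring

theorem mergeSum_mul (c : ZMod 2) (a : List G → ZMod 2) (l : List G) :
    mergeSum (fun t => c * a t) l = c * mergeSum a l := by
  induction l generalizing a with
  | nil => simp [mergeSum]
  | cons u l ih =>
    cases l with
    | nil => rfl
    | cons v l => simp only [mergeSum, ih]; ring

theorem listCoboundary_add (a b : List G → ZMod 2) (l : List G) :
    listCoboundary (fun t => a t + b t) l = listCoboundary a l + listCoboundary b l := by
  cases l with
  | nil => rfl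
  | cons u l => simp only [listCoboundary, mergeSum_add]; ring

theorem mergeSum_congr {n : ℕ} {a b : List G → ZMod 2} (h : ∀ l, l.length = n → a l = b l)
    (l : List G) (hl : l.length = n + 1) : mergeSum a l = mergeSum b l := by
  induction l generalizing a b n with
  | nil => rfl
  | cons u l ih =>
    cases l with
    | nil => exact h _ (by simpa [eq_comm] using hl)
    | cons v l =>
      obtain rfl : l.length + 1 = n := by simpa using hl
      rw [mergeSum, mergeSum, h _ rfl, ih (fun t ht => h _ (by simpa using ht)) rfl]

theorem mergeSum_comp_map {H : Type*} [Group H] (f : H →* G) (a : List G → ZMod 2) (l : List H) :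
    mergeSum (fun t => a (t.map f)) l = mergeSum a (l.map f) := by
  induction l generalizing a with
  | nil => rfl
  | cons u l ih =>
    cases l with
    | nil => rfl
    | cons v l =>
      simp only [mergeSum, List.map_cons, map_mul]
      rw [ih fun t => a (f u :: t), List.map_cons]

theorem listCoboundary_comp_map {H : Type*} [Group H] (f : H →* G) (a : List G → ZMod 2)
    (l : List H) : listCoboundary (fun t => a (t.map f)) l = listCoboundary a (l.map f) := by
  cases l with
  | nil => rfl
  | cons u l => rw [listCoboundary, mergeSum_comp_map, List.map_cons, listCoboundary]

/-- Merging an entry 1 with its left or its right neighbour yields the same list; if it is the last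
entry, dropping it replaces the right merge. A 1 at the head is excluded, since its cancelling
partner is the face that drops the first entry. -/
theorem mergeSum_isNormalized {a : List G → ZMod 2} (ha : IsNormalized a) (u : G) (l : List G)
    (hl : 1 ∈ l) : mergeSum a (u :: l) = 0 := by
  induction l generalizing a u with
  | nil => simp at hl
  | cons v l ih =>
    rw [mergeSum]
    by_cases h : 1 ∈ l
    · rw [ih (ha.cons u) v h, ha _ (by simp [h]), add_zero]
    · obtain rfl : 1 = v := by simpa [h] using hl
      cases l with
      | nil => simp [mergeSum, CharTwo.add_self_eq_zero]
      | cons w l =>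
        have h0 : mergeSum (fun t => a (u :: 1 :: t)) (w :: l) = 0 :=
          (mergeSum_congr (n := l.length) (b := fun _ => 0 * (0 : ZMod 2))
            (fun t _ => by rw [ha _ (by simp), zero_mul]) _ rfl).trans
              ((mergeSum_mul 0 (fun _ => 0) _).trans (zero_mul _))
        rw [mergeSum, h0]
        simp [CharTwo.add_self_eq_zero]

theorem IsNormalized.listCoboundary {a : List G → ZMod 2} (ha : IsNormalized a) :
    IsNormalized (listCoboundary a) := by
  intro l hl
  cases l with
  | nil => rfl
  | cons u l =>
    rw [NormalizedCohomology.listCoboundary]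
    by_cases h : 1 ∈ l
    · rw [mergeSum_isNormalized ha u l h, ha _ h, add_zero]
    · obtain rfl : 1 = u := by simpa [h] using hl
      cases l with
      | nil => simp [mergeSum, CharTwo.add_self_eq_zero]
      | cons v l =>
        have h0 : mergeSum (fun t => a (1 :: t)) (v :: l) = 0 :=
          (mergeSum_congr (n := l.length) (b := fun _ => 0 * (0 : ZMod 2))
            (fun t _ => by rw [ha _ (by simp), zero_mul]) _ rfl).trans
              ((mergeSum_mul 0 (fun _ => 0) _).trans (zero_mul _))
        rw [mergeSum, h0]
        simp [CharTwo.add_self_eq_zero]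

@[simp] theorem length_partialProds (g : G) (l : List G) :
    (partialProds g l).length = l.length + 1 := by
  induction l generalizing g with
  | nil => rfl
  | cons u l ih => simp [partialProds, ih]

theorem partialProds_eq_cons (g : G) (l : List G) : ∃ t, partialProds g l = g :: t := by
  cases l <;> exact ⟨_, rfl⟩

theorem partialProds_mul (h g : G) (l : List G) :
    partialProds (h * g) l = (partialProds g l).map (h * ·) := by
  induction l generalizing g with
  | nil => rfl
  | cons u l ih => simp [partialProds, mul_assoc, ih]

theorem not_isChain_partialProds (g : G) (l : List G) (hl : 1 ∈ l) :
    ¬ (partialProds g l).IsChain (· ≠ ·) := by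
  induction l generalizing g with
  | nil => simp at hl
  | cons u l ih =>
    rw [partialProds]
    by_cases h : 1 ∈ l
    · exact fun hc => ih _ h hc.tail
    · obtain rfl : 1 = u := by simpa [h] using hl
      obtain ⟨t, ht⟩ := partialProds_eq_cons (g * 1) l
      simp [ht, -mul_one]

theorem quotients_partialProds (g : G) (l : List G) : quotients (partialProds g l) = l := by
  induction l generalizing g with
  | nil => rfl
  | cons u l ih =>
    have := ih (g * u)
    obtain ⟨t, ht⟩ := partialProds_eq_cons (g * u) l
    rw [ht] at this
    rw [partialProds, ht, quotients, this, inv_mul_cancel_left]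

theorem exists_eq_partialProds (l : List G) (hl : l ≠ []) : ∃ g t, l = partialProds g t := by
  induction l with
  | nil => exact absurd rfl hl
  | cons x l ih =>
    cases l with
    | nil => exact ⟨x, [], rfl⟩
    | cons y l =>
      obtain ⟨g, t, h⟩ := ih (by simp)
      refine ⟨x, x⁻¹ * g :: t, ?_⟩
      rw [partialProds, mul_inv_cancel_left, ← h]

theorem quotients_map_mul (h : G) (l : List G) : quotients (l.map (h * ·)) = quotients l := by
  rcases eq_or_ne l [] with rfl | hl
  · rfl
  · obtain ⟨g, t, rfl⟩ := exists_eq_partialProds l hl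
    rw [← partialProds_mul, quotients_partialProds, quotients_partialProds]

theorem one_mem_quotients (l : List G) (hl : ¬ l.IsChain (· ≠ ·)) : 1 ∈ quotients l := by
  induction l with
  | nil => simp at hl
  | cons x l ih =>
    cases l with
    | nil => simp at hl
    | cons y l =>
      rw [quotients]
      by_cases h : (y :: l).IsChain (· ≠ ·)
      · obtain rfl : x = y := by simpa [h] using hl
        simp
      · exact List.mem_cons_of_mem _ (ih h)

theorem quotients_mem (H : Subgroup G) (l : List G) (hl : ∀ x ∈ l, x ∈ H) :
    ∀ x ∈ quotients l, x ∈ H := by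
  induction l with
  | nil => simp [quotients]
  | cons x l ih =>
    cases l with
    | nil => simp [quotients]
    | cons y l =>
      rw [quotients]
      have := ih fun z hz => hl z (List.mem_cons_of_mem _ hz)
      simp only [List.mem_cons, forall_eq_or_imp]
      exact ⟨H.mul_mem (H.inv_mem (hl x (by simp))) (hl y (by simp)), this⟩

/-- The homogeneous differential in terms of the inhomogeneous one. -/
theorem omitSum_partialProds (B : List G → ZMod 2) (g u : G) (l : List G) :
    omitSum B (partialProds g (u :: l)) =
      B (partialProds (g * u) l) + mergeSum (fun t => B (partialProds g t)) (u :: l) := by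
  induction l generalizing B g u with
  | nil => simp [partialProds, omitSum, mergeSum]
  | cons v l ih =>
    rw [partialProds, omitSum, ih, mergeSum]
    simp only [partialProds, mul_assoc]

theorem listCoboundary_listCoboundary (a : List G → ZMod 2) (l : List G) :
    listCoboundary (listCoboundary a) l = 0 := by
  let A : List G → ZMod 2 := fun l => a (quotients l)
  have hA : ∀ g u t, omitSum A (partialProds g (u :: t)) = listCoboundary a (u :: t) :=
    fun g u t => by
      rw [omitSum_partialProds, listCoboundary]
      simp only [A, quotients_partialProds]
  match l with
  | [] => rfl
  -- This case is separate because `hA` fails for the empty list: `omitSum A [g]` is `a []`, whereas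
  -- `listCoboundary a []` is 0.
  | [u] => simp [listCoboundary, mergeSum]
  | u :: v :: l =>
    have h := omitSum_partialProds (omitSum A) 1 u (v :: l)
    rw [omitSum_omitSum, hA, mergeSum_congr (n := l.length + 1) (b := listCoboundary a) ?_ _ rfl]
      at h
    · rw [listCoboundary, h]
    · intro t ht
      cases t with
      | nil => simp at ht
      | cons w t => exact hA _ _ _

theorem length_quotients (l : List G) : (quotients l).length = l.length - 1 := by
  rcases eq_or_ne l [] with rfl | hl
  · rfl
  · obtain ⟨g, t, rfl⟩ := exists_eq_partialProds l hl
    simp [quotients_partialProds]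

/-! ### Splitting off a character. -/

theorem zmod_two_eq_zero_or_one (c : ZMod 2) : c = 0 ∨ c = 1 := by
  revert c; decide

/-- A cocycle that vanishes on the kernel of a surjective character `χ : G → 𝔽₂` is cohomologous
to a product of `χ` with a cocycle. -/
theorem exists_eq_character_mul_add_listCoboundary (χ : G →* Multiplicative (ZMod 2)) {s : G}
    (hs : (χ s).toAdd = 1) {n : ℕ} {a : List G → ZMod 2} (ha : IsNormalized a)
    (hc : ∀ l, l.length = n + 2 → listCoboundary a l = 0)
    (h0 : ∀ l, l.length = n + 1 → (∀ x ∈ l, x ∈ χ.ker) → a l = 0) :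
    ∃ b c : List G → ZMod 2, IsNormalized b ∧ IsNormalized c ∧
      (∀ l, l.length = n + 1 → listCoboundary b l = 0) ∧
      ∀ u l, l.length = n → a (u :: l) = (χ u).toAdd * b l + listCoboundary c (u :: l) := by
  have hker : ∀ g, g ∈ χ.ker ↔ (χ g).toAdd = 0 := fun g => by
    rw [MonoidHom.mem_ker]; exact Iff.rfl
  have hmul : ∀ g h, (χ (g * h)).toAdd = (χ g).toAdd + (χ h).toAdd := fun g h => by
    rw [map_mul, toAdd_mul]
  have hinv : ∀ g, (χ g⁻¹).toAdd = (χ g).toAdd := fun g => by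
    rw [map_inv, toAdd_inv, CharTwo.neg_eq]
  -- A retraction onto the kernel of `χ`. The factor `s` stands on the right, so that `ρ` commutes
  -- with left translations by the kernel.
  let ρ : G → G := fun g => if (χ g).toAdd = 0 then g else g * s
  have hρ : ∀ g, ρ g ∈ χ.ker := fun g => by
    rcases zmod_two_eq_zero_or_one (χ g).toAdd with h | h
    · simp only [ρ, h, if_true]; exact (hker g).2 h
    · simp only [ρ, h]; rw [if_neg (by decide), hker, hmul, h, hs]; decide
  have hρm : ∀ h ∈ χ.ker, ∀ g, h * ρ g = ρ (h * g) := fun h hh g => by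
    simp only [ρ, hmul, (hker h).1 hh, zero_add, mul_ite, mul_assoc]
  let A : List G → ZMod 2 := fun l => a (quotients l)
  let f : G → List G → ZMod 2 := fun g l => prism ρ A (partialProds g l)
  have hA : ∀ g, (fun t => A (partialProds g t)) = a := fun g => funext fun t => by
    simp only [A, quotients_partialProds]
  have hdA : ∀ l, l.length = n + 3 → omitSum A l = 0 := fun l hl => by
    obtain ⟨g, t, rfl⟩ := exists_eq_partialProds l (by rintro rfl; simp at hl)
    cases t with
    | nil => simp at hl
    | cons u t =>
      rw [omitSum_partialProds, hA, ← hc (u :: t) (by simpa using hl), listCoboundary]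
      simp only [A, quotients_partialProds]
  -- The prism of `A` bounds `A`: `A` is a cocycle, and `A ∘ ρ` vanishes by `h0`. The prism is not
  -- invariant under all of `G`, so its inhomogeneous form depends on the base point `g`. Dropping
  -- the first entry moves the base point to `g * u`, while `listCoboundary (f g)` keeps `g`; this
  -- produces the two extra terms.
  have hf : ∀ g u l, l.length = n →
      listCoboundary (f g) (u :: l) = a (u :: l) + f g l + f (g * u) l := fun g u l hl => by
    have h1 := omitSum_prism_add_prism_omitSum ρ A (partialProds g (u :: l))
    rw [prism_eq_zero (n := n + 2) hdA _ (by simp [hl]), omitSum_partialProds] at h1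
    have h2 : A ((partialProds g (u :: l)).map ρ) = 0 :=
      h0 _ (by simp [length_quotients, hl]) (quotients_mem _ _ fun x hx => by
        obtain ⟨y, _, rfl⟩ := List.mem_map.1 hx
        exact hρ y)
    have h3 : A (partialProds g (u :: l)) = a (u :: l) := by simp only [A, quotients_partialProds]
    rw [h2, h3] at h1
    rw [listCoboundary]
    simp only [f]
    linear_combination h1 + CharTwo.add_self_eq_zero (prism ρ A (partialProds g l)) -
      CharTwo.add_self_eq_zero (prism ρ A (partialProds (g * u) l))
      - CharTwo.add_self_eq_zero (prism ρ A (partialProds g l))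
  have hfn : ∀ g, IsNormalized (f g) := fun g l hl =>
    prism_eq_zero_of_not_isChain (fun t ht => ha _ (one_mem_quotients t ht)) _
      (not_isChain_partialProds g l hl)
  have hfm : ∀ h ∈ χ.ker, ∀ g, f (h * g) = f g := fun h hh g => funext fun l => by
    simp only [f]
    rw [partialProds_mul, ← prism_comp_map (hρm h hh)]
    simp only [A, quotients_map_mul]
  -- By invariance under the kernel only the two functions `f 1` and `f s` remain.
  have hfeq : ∀ g k, (χ g).toAdd = (χ k).toAdd → f g = f k := fun g k h => by
    rw [← hfm (g * k⁻¹) ((hker _).2 (by rw [hmul, hinv, h, CharTwo.add_self_eq_zero])) k,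
      inv_mul_cancel_right]
  have h1 : (χ 1).toAdd = 0 := by rw [map_one]; rfl
  have hmain : ∀ u l, l.length = n →
      listCoboundary (f 1) (u :: l) = a (u :: l) + (χ u).toAdd * (f 1 l + f s l) ∧
      listCoboundary (f s) (u :: l) = a (u :: l) + (χ u).toAdd * (f 1 l + f s l) := by
    intro u l hl
    rw [hf _ _ _ hl, hf _ _ _ hl]
    rcases zmod_two_eq_zero_or_one (χ u).toAdd with h | h
    · rw [hfeq (1 * u) 1 (by rw [hmul, h1, h, add_zero]), hfeq (s * u) s (by rw [hmul, h, add_zero]),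
        h, add_assoc, add_assoc, CharTwo.add_self_eq_zero, CharTwo.add_self_eq_zero]
      simp
    · rw [hfeq (1 * u) s (by rw [hmul, h1, h, hs, zero_add]),
        hfeq (s * u) 1 (by rw [hmul, h, h1, hs]; decide), h]
      constructor <;> ring
  -- By `hmain`, `f 1` and `f s` have the same coboundary `a + χ ∪ (f 1 + f s)`; hence their sum is
  -- a cocycle, and `f 1` is the correction term.
  refine ⟨fun l => f 1 l + f s l, f 1, (hfn 1).add (hfn s), hfn 1, fun l hl => ?_, fun u l hl => ?_⟩
  · cases l with
    | nil => rfl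
    | cons u l =>
      have hl' : l.length = n := by simpa using hl
      rw [listCoboundary_add, (hmain u l hl').1, (hmain u l hl').2, CharTwo.add_self_eq_zero]
  · rw [(hmain u l hl).1]
    linear_combination -CharTwo.add_self_eq_zero ((χ u).toAdd * (f 1 l + f s l))

end ListCochain

open MvPolynomial

/-! ### Evaluation at the generators, and vanishing on coboundaries. -/

section Evaluation

variable {G : Type*} {r : ℕ}

/-- The polynomial `∑ a(s_{i₁}, …, s_{iₙ}) x_{i₁} ⋯ x_{iₙ}`, by recursion on `n`. -/
noncomputable def genPoly (s : Fin r → G) :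
    ℕ → (List G → ZMod 2) → MvPolynomial (Fin r) (ZMod 2)
  | 0, a => C (a [])
  | n + 1, a => ∑ x, X x * genPoly s n (fun t => a (s x :: t))

theorem genPoly_eq_sum (s : Fin r → G) (n : ℕ) (a : List G → ZMod 2) :
    genPoly s n a = ∑ i : Fin n → Fin r, a (List.ofFn fun j => s (i j)) • ∏ j, X (i j) := by
  induction n generalizing a with
  | zero => simp [genPoly, MvPolynomial.smul_eq_C_mul]
  | succ n ih =>
    rw [genPoly, ← (Fin.consEquiv fun _ => Fin r).sum_comp, Fintype.sum_prod_type]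
    refine Finset.sum_congr rfl fun x _ => ?_
    rw [ih, Finset.mul_sum]
    refine Finset.sum_congr rfl fun i _ => ?_
    simp [Fin.consEquiv, Fin.prod_univ_succ, List.ofFn_succ]

theorem genPoly_congr (s : Fin r → G) {n : ℕ} {a b : List G → ZMod 2}
    (h : ∀ l, l.length = n → a l = b l) : genPoly s n a = genPoly s n b := by
  induction n generalizing a b with
  | zero => rw [genPoly, genPoly, h _ rfl]
  | succ n ih =>
    exact Finset.sum_congr rfl fun x _ => by rw [ih fun t ht => h _ (by simpa using ht)]

theorem genPoly_add (s : Fin r → G) (n : ℕ) (a b : List G → ZMod 2) :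
    genPoly s n (fun t => a t + b t) = genPoly s n a + genPoly s n b := by
  induction n generalizing a b with
  | zero => simp [genPoly]
  | succ n ih => simp only [genPoly, ih, mul_add, Finset.sum_add_distrib]

theorem genPoly_mul (s : Fin r → G) (n : ℕ) (c : ZMod 2) (a : List G → ZMod 2) :
    genPoly s n (fun t => c * a t) = C c * genPoly s n a := by
  induction n generalizing a with
  | zero => simp [genPoly]
  | succ n ih => simp only [genPoly, ih, Finset.mul_sum, mul_left_comm]

theorem genPoly_zero (s : Fin r → G) (n : ℕ) : genPoly s n (fun _ => 0) = 0 := by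
  simpa using genPoly_mul s n 0 (fun _ => 0)

theorem genPoly_isHomogeneous (s : Fin r → G) (n : ℕ) (a : List G → ZMod 2) :
    (genPoly s n a).IsHomogeneous n := by
  induction n generalizing a with
  | zero => exact isHomogeneous_C _ _
  | succ n ih =>
    refine IsHomogeneous.sum _ _ _ fun x _ => ?_
    rw [add_comm n]
    exact (isHomogeneous_X _ x).mul (ih _)

/-- Setting the first variable to `0` restricts to the remaining generators. -/
theorem genPoly_comp_map {H : Type*} (f : H → G) (s : Fin (r + 1) → G) (s' : Fin r → H)
    (hs : ∀ i, f (s' i) = s i.succ) (n : ℕ) (a : List G → ZMod 2) :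
    genPoly s' n (fun t => a (t.map f)) =
      aeval (Fin.cases 0 X : Fin (r + 1) → MvPolynomial (Fin r) (ZMod 2)) (genPoly s n a) := by
  induction n generalizing a with
  | zero => simp [genPoly]
  | succ n ih =>
    rw [genPoly, genPoly, map_sum, Fin.sum_univ_succ]
    simp only [map_mul, aeval_X, Fin.cases_zero, zero_mul, Fin.cases_succ, zero_add]
    refine Finset.sum_congr rfl fun x _ => ?_
    rw [← ih fun t => a (s x.succ :: t)]
    simp only [List.map_cons, hs]

theorem sum_sum_eq_zero_of_symm {ι R : Type*} [Fintype ι] [CommRing R] [CharP R 2]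
    (f : ι → ι → R) (h : ∀ i j, f i j = f j i) (h0 : ∀ i, f i i = 0) : ∑ i, ∑ j, f i j = 0 := by
  classical
  rw [← Fintype.sum_prod_type']
  refine Finset.sum_involution (fun p _ => p.swap) (fun p _ => ?_) (fun p _ hp he => ?_)
    (fun _ _ => Finset.mem_univ _) (fun _ _ => Prod.swap_swap _)
  · rw [Prod.fst_swap, Prod.snd_swap, h p.2 p.1, CharTwo.add_self_eq_zero]
  · have : p.2 = p.1 := congrArg Prod.fst he
    exact hp (by rw [this, h0])

variable [Group G]

/-- Only the face that drops the last entry survives, and it contributes the factor `∑ x, X x`. Each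
merging face gives a sum symmetric in the two merged indices, with zero diagonal by normalization.
-/
theorem genPoly_mergeSum (s : Fin r → G) (hs : ∀ i j, s i * s j = s j * s i)
    (hs2 : ∀ i, s i * s i = 1) (n : ℕ) {a : List G → ZMod 2} (ha : IsNormalized a) :
    genPoly s (n + 1) (mergeSum a) = (∑ x, X x) * genPoly s n a := by
  induction n generalizing a with
  | zero => simp [genPoly, mergeSum, Finset.sum_mul]
  | succ n ih =>
    have h1 : ∀ x y, genPoly s n (fun t => mergeSum a (s x :: s y :: t)) =
        genPoly s n (fun t => a (s x * s y :: t)) +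
          genPoly s n (fun t => mergeSum (fun t => a (s x :: t)) (s y :: t)) := fun x y => by
      simp only [mergeSum, genPoly_add]
    have h2 : ∀ x, ∑ y, X y * genPoly s n (fun t => mergeSum (fun t => a (s x :: t)) (s y :: t)) =
        (∑ y, X y) * genPoly s n (fun t => a (s x :: t)) := fun x => ih (ha.cons (s x))
    have h3 : ∑ x, ∑ y, X x * (X y * genPoly s n (fun t => a (s x * s y :: t))) = 0 := by
      refine sum_sum_eq_zero_of_symm _ (fun x y => ?_) (fun x => ?_)
      · rw [hs, mul_left_comm]
      · rw [genPoly_congr (b := fun _ => 0) s (fun t _ => ha _ (by simp [hs2])), genPoly_zero,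
          mul_zero, mul_zero]
    rw [genPoly]
    simp only [genPoly, h1, mul_add, Finset.sum_add_distrib, h2]
    simp only [Finset.mul_sum] at h3 ⊢
    rw [h3, zero_add]
    rw [Finset.sum_congr rfl fun x _ => ?_]
    simp only [Finset.sum_mul, Finset.mul_sum, mul_left_comm]

/-- The face that drops the first entry also contributes `(∑ x, X x) * genPoly s n a`, and the two
copies cancel modulo 2. -/
theorem genPoly_listCoboundary (s : Fin r → G) (hs : ∀ i j, s i * s j = s j * s i)
    (hs2 : ∀ i, s i * s i = 1) (n : ℕ) {a : List G → ZMod 2} (ha : IsNormalized a) :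
    genPoly s (n + 1) (listCoboundary a) = 0 := by
  have h := genPoly_mergeSum s hs hs2 n ha
  simp only [genPoly, listCoboundary, genPoly_add, mul_add, Finset.sum_add_distrib] at h ⊢
  rw [h, Finset.sum_mul, CharTwo.add_self_eq_zero]

/-! ### Cocycles with zero polynomial are coboundaries. -/

/-- The product of a character with a cochain. -/
def charMul (χ : G →* Multiplicative (ZMod 2)) (c : List G → ZMod 2) : List G → ZMod 2
  | [] => 0
  | u :: l => (χ u).toAdd * c l

theorem IsNormalized.charMul (χ : G →* Multiplicative (ZMod 2)) {c : List G → ZMod 2}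
    (hc : IsNormalized c) : IsNormalized (charMul χ c) := by
  intro l hl
  cases l with
  | nil => rfl
  | cons u l =>
    rw [NormalizedCohomology.charMul]
    rcases List.mem_cons.1 hl with rfl | h
    · rw [map_one, toAdd_one, zero_mul]
    · rw [hc l h, mul_zero]

/-- The Leibniz rule for a factor `χ` that is itself a cocycle, being a homomorphism. -/
theorem listCoboundary_charMul (χ : G →* Multiplicative (ZMod 2)) (c : List G → ZMod 2) (u : G)
    (l : List G) : listCoboundary (charMul χ c) (u :: l) = (χ u).toAdd * listCoboundary c l := by
  cases l with
  | nil => simp [listCoboundary, mergeSum, charMul]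
  | cons v l =>
    simp only [listCoboundary, mergeSum, charMul, mergeSum_mul, map_mul, toAdd_mul]
    linear_combination CharTwo.add_self_eq_zero ((χ v).toAdd * c l)

/-- A cocycle of an elementary abelian `2`-group with zero polynomial is a coboundary. The group
is given by elements `s i` and characters `χ i` dual to them that separate points. -/
theorem exists_eq_listCoboundary_of_genPoly_eq_zero {r : ℕ} {G : Type*} [Group G] (s : Fin r → G)
    (χ : Fin r → G →* Multiplicative (ZMod 2))
    (hχ : ∀ i j, (χ i (s j)).toAdd = if i = j then 1 else 0)
    (hsep : ∀ g, (∀ i, χ i g = 1) → g = 1) (n : ℕ) {a : List G → ZMod 2} (ha : IsNormalized a)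
    (hc : ∀ l, l.length = n + 1 → listCoboundary a l = 0) (h0 : genPoly s n a = 0) :
    ∃ c, IsNormalized c ∧ ∀ l, l.length = n → a l = listCoboundary c l := by
  classical
  -- The outer induction must allow the group to shrink to a kernel and the degree to vary; the
  -- inner induction on the degree keeps the group fixed.
  induction r generalizing G n with
  | zero =>
    refine ⟨fun _ => 0, fun _ _ => rfl, fun l hl => ?_⟩
    have hz : ∀ l : List G, listCoboundary (fun _ => 0) l = 0 := fun l => by
      simpa using listCoboundary_add (fun _ => 0) (fun _ => 0) l
    rw [hz]
    cases l with
    | nil =>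
      subst hl
      exact C_injective _ _ (h0.trans C_0.symm)
    | cons u l => exact ha _ (by rw [hsep u fun i => i.elim0]; simp)
  | succ r ihr =>
    have hcomm : ∀ g h : G, g * h = h * g := fun g h => by
      rw [← mul_inv_eq_one, mul_inv_rev]
      refine hsep _ fun i => ?_
      simp only [map_mul, map_inv]
      rw [mul_comm (χ i g), mul_assoc, ← mul_assoc (χ i g), mul_inv_cancel, one_mul,
        mul_inv_cancel]
    have hsq : ∀ g : G, g * g = 1 := fun g => hsep _ fun i => by
      rw [map_mul]
      exact CharTwo.add_self_eq_zero (χ i g).toAdd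
    induction n generalizing a with
    | zero =>
      -- `listCoboundary` is 0 at the empty list, matching `B⁰ = 0`, so in degree 0 the claim is
      -- that `a []` vanishes; this is the constant polynomial of `a`.
      refine ⟨fun _ => 0, fun _ _ => rfl, fun l hl => ?_⟩
      obtain rfl := List.length_eq_zero_iff.1 hl
      exact C_injective _ _ (h0.trans C_0.symm)
    | succ n ihn =>
      let H := (χ 0).ker
      have hmem : ∀ i : Fin r, s i.succ ∈ H := fun i =>
        (hχ 0 i.succ).trans (if_neg (Fin.succ_ne_zero i).symm)
      let s' : Fin r → H := fun i => ⟨s i.succ, hmem i⟩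
      obtain ⟨c, hcn, hac⟩ := ihr s' (fun i => (χ i.succ).comp H.subtype)
        (fun i j => (hχ i.succ j.succ).trans (by simp))
        (fun g hg => Subtype.ext (hsep g fun i => by
          cases i using Fin.cases with
          | zero => exact g.2
          | succ i => exact hg i)) (n + 1) (a := fun t => a (t.map H.subtype))
        (fun l hl => ha _ (List.mem_map.2 ⟨1, hl, rfl⟩))
        (fun l hl => by rw [listCoboundary_comp_map, hc _ (by simpa using hl)])
        (by rw [genPoly_comp_map H.subtype s s' (fun _ => rfl), h0, map_zero])
      -- Extension of `c` by zero from `H` to `G`. Any normalized extension would do, since only its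
      -- restriction to `H` has to be `c`.
      let c' : List G → ZMod 2 := fun t =>
        if h : ∀ x ∈ t, x ∈ H then c (t.pmap Subtype.mk h) else 0
      have hc' : IsNormalized c' := fun l hl => by
        simp only [c']
        split_ifs with h
        · exact hcn _ (List.mem_pmap.2 ⟨1, hl, rfl⟩)
        · rfl
      have hcc : (fun t => c' (t.map H.subtype)) = c := funext fun t => by
        have h : ∀ x ∈ t.map H.subtype, x ∈ H := fun x hx => by
          obtain ⟨y, _, rfl⟩ := List.mem_map.1 hx
          exact y.2
        simp only [c', dif_pos h]
        congr 1
        refine List.map_injective_iff.2 H.subtype_injective ?_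
        rw [List.map_pmap]
        simp
      obtain ⟨b, e, hb, he, hdb, hab⟩ := exists_eq_character_mul_add_listCoboundary (χ 0)
        (s := s 0) (by simp [hχ]) (n := n) (ha.add hc'.listCoboundary)
        (fun l hl => by
          rw [listCoboundary_add, hc l hl, listCoboundary_listCoboundary, add_zero])
        (fun l hl hlH => by
          have hl' : l = (l.pmap Subtype.mk hlH).map H.subtype := by
            rw [List.map_pmap]; simp
          rw [hl', ← listCoboundary_comp_map, hcc, hac _ (by simpa using hl),
            CharTwo.add_self_eq_zero])
      have hab' : ∀ l, l.length = n + 1 →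
          a l + listCoboundary c' l = charMul (χ 0) b l + listCoboundary e l := fun l hl => by
        cases l with
        | nil => simp at hl
        | cons u l => exact hab u l (by simpa using hl)
      have hW := genPoly_congr s hab'
      -- Among the generators only `s 0` has a nonzero value under `χ 0`.
      have hcm : genPoly s (n + 1) (charMul (χ 0) b) = X 0 * genPoly s n b := by
        simp only [genPoly, charMul, hχ, genPoly_mul]
        rw [Finset.sum_eq_single 0 (fun x _ hx => by simp [Ne.symm hx]) (by simp)]
        simp
      rw [genPoly_add, genPoly_add, genPoly_listCoboundary s (fun _ _ => hcomm _ _) (fun _ => hsq _)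
        _ hc', genPoly_listCoboundary s (fun _ _ => hcomm _ _) (fun _ => hsq _) _ he, h0, hcm,
        add_zero, add_zero] at hW
      obtain ⟨k, hk, hbk⟩ := ihn hb hdb ((mul_eq_zero.1 hW.symm).resolve_left (X_ne_zero 0))
      -- From `a + dc' = χ 0 ∪ b + de` and `b = dk`.
      refine ⟨fun t => charMul (χ 0) k t + (e t + c' t), (hk.charMul _).add (he.add hc'),
        fun l hl => ?_⟩
      have h1 := hab' l hl
      cases l with
      | nil => simp at hl
      | cons u l =>
        rw [listCoboundary_add, listCoboundary_add, listCoboundary_charMul,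
          ← hbk l (by simpa using hl)]
        rw [charMul] at h1
        linear_combination h1 - CharTwo.add_self_eq_zero (listCoboundary c' (u :: l))

end Evaluation

/-! ### Cochains on tuples versus functions on lists. -/

section Comparison

variable {G : Type*} {n : ℕ}

/-- The extension of a cochain of degree `n` by zero to lists of all lengths. -/
def extendList (a : (Fin n → G) → ZMod 2) : List G → ZMod 2 :=
  fun l => if h : l.length = n then a (fun i => l.get (i.cast h.symm)) else 0

theorem extendList_ofFn (a : (Fin n → G) → ZMod 2) (u : Fin n → G) :
    extendList a (List.ofFn u) = a u := by
  rw [extendList, dif_pos (List.length_ofFn)]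
  congr 1
  funext i
  simp

theorem exists_eq_ofFn (l : List G) (hl : l.length = n) : ∃ u : Fin n → G, l = List.ofFn u := by
  subst hl
  exact ⟨l.get, (List.ofFn_get l).symm⟩

variable [Group G]

theorem isNormalized_extendList {a : (Fin n → G) → ZMod 2} (ha : a ∈ Cochain G n) :
    IsNormalized (extendList a) := by
  intro l hl
  by_cases h : l.length = n
  · obtain ⟨u, rfl⟩ := exists_eq_ofFn l h
    rw [extendList_ofFn]
    obtain ⟨i, hi⟩ := List.mem_ofFn.1 hl
    exact ha u ⟨i, hi⟩
  · exact dif_neg h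

theorem IsNormalized.mem_cochain {c : List G → ZMod 2} (hc : IsNormalized c) (n : ℕ) :
    (fun u : Fin n → G => c (List.ofFn u)) ∈ Cochain G n :=
  fun _ ⟨i, hi⟩ => hc _ (List.mem_ofFn.2 ⟨i, hi⟩)

/-- The index 0 merges the first two entries, and the later indices leave the head fixed and act on
the tail; this is the recursion of `mergeSum`. -/
theorem sum_contractNth_eq_mergeSum (c : List G → ZMod 2) (u : Fin (n + 1) → G) :
    ∑ j : Fin (n + 1), c (List.ofFn (Fin.contractNth j (· * ·) u)) = mergeSum c (List.ofFn u) := by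
  induction n generalizing c with
  | zero => simp [mergeSum]
  | succ n ih =>
    have h0 : List.ofFn (Fin.contractNth 0 (· * ·) u) =
        u 0 * u 1 :: List.ofFn fun i : Fin n => u i.succ.succ := by
      rw [List.ofFn_succ, Fin.contractNth_apply_of_eq _ _ _ _ rfl]
      refine congrArg₂ List.cons rfl (congrArg List.ofFn (funext fun i => ?_))
      rw [Fin.contractNth_apply_of_gt _ _ _ _ (by simp)]
    have h1 : ∀ j : Fin (n + 1), List.ofFn (Fin.contractNth j.succ (· * ·) u) =
        u 0 :: List.ofFn (Fin.contractNth j (· * ·) fun i : Fin (n + 1) => u i.succ) := by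
      intro j
      rw [List.ofFn_succ, Fin.contractNth_apply_of_lt _ _ _ _ (by simp)]
      refine congrArg₂ List.cons rfl (congrArg List.ofFn (funext fun i => ?_))
      simp [Fin.contractNth]
    rw [Fin.sum_univ_succ, h0]
    simp only [h1]
    rw [ih fun t => c (u 0 :: t), List.ofFn_succ, List.ofFn_succ, List.ofFn_succ, mergeSum]
    rfl

theorem coboundaryFun_ofFn (c : List G → ZMod 2) (u : Fin (n + 1) → G) :
    coboundaryFun G n (fun v => c (List.ofFn v)) u = listCoboundary c (List.ofFn u) := by
  rw [coboundaryFun_apply, sum_contractNth_eq_mergeSum, List.ofFn_succ, listCoboundary]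

theorem coboundaryFun_extendList (a : (Fin n → G) → ZMod 2) (u : Fin (n + 1) → G) :
    coboundaryFun G n a u = listCoboundary (extendList a) (List.ofFn u) := by
  rw [← coboundaryFun_ofFn]
  simp only [extendList_ofFn]

end Comparison

/-! ### The algebra homomorphism from cohomology to polynomials. -/

section Polynomial

variable {G : Type*} {r : ℕ}

/-- The linear map `a ↦ ∑ a(s_{i₁}, …, s_{iₙ}) x_{i₁} ⋯ x_{iₙ}`. -/
noncomputable def evalPoly (s : Fin r → G) (n : ℕ) :
    ((Fin n → G) → ZMod 2) →ₗ[ZMod 2] MvPolynomial (Fin r) (ZMod 2) where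
  toFun a := ∑ i : Fin n → Fin r, a (fun j => s (i j)) • ∏ j, X (i j)
  map_add' a b := by simp only [Pi.add_apply, add_smul, Finset.sum_add_distrib]
  map_smul' c a := by
    simp only [Pi.smul_apply, smul_assoc, RingHom.id_apply, Finset.smul_sum]

theorem evalPoly_apply (s : Fin r → G) (n : ℕ) (a : (Fin n → G) → ZMod 2) :
    evalPoly s n a = ∑ i : Fin n → Fin r, a (fun j => s (i j)) • ∏ j, X (i j) := rfl

theorem evalPoly_eq_genPoly (s : Fin r → G) (n : ℕ) (a : (Fin n → G) → ZMod 2) :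
    evalPoly s n a = genPoly s n (extendList a) := by
  simp only [evalPoly_apply, genPoly_eq_sum, extendList_ofFn]

theorem evalPoly_isHomogeneous (s : Fin r → G) (n : ℕ) (a : (Fin n → G) → ZMod 2) :
    (evalPoly s n a).IsHomogeneous n := by
  rw [evalPoly_eq_genPoly]
  exact genPoly_isHomogeneous s n _

/-- An index tuple of length `m + n` is a pair of tuples of lengths `m` and `n`, and both the cup
product and the monomial factor along this splitting. -/
theorem evalPoly_cupFun (s : Fin r → G) {m n : ℕ} (a : (Fin m → G) → ZMod 2)
    (b : (Fin n → G) → ZMod 2) :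
    evalPoly s (m + n) (cupFun a b) = evalPoly s m a * evalPoly s n b := by
  simp only [evalPoly_apply]
  rw [← (Fin.appendEquiv m n).sum_comp, Fintype.sum_prod_type, Finset.sum_mul_sum]
  refine Finset.sum_congr rfl fun i _ => Finset.sum_congr rfl fun j _ => ?_
  simp [cupFun, Fin.appendEquiv, Fin.prod_univ_add, mul_smul_mul_comm]

variable [Group G]

theorem evalPoly_coboundaryFun (s : Fin r → G) (hs : ∀ i j, s i * s j = s j * s i)
    (hs2 : ∀ i, s i * s i = 1) {n : ℕ} {a : (Fin n → G) → ZMod 2} (ha : a ∈ Cochain G n) :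
    evalPoly s (n + 1) (coboundaryFun G n a) = 0 := by
  rw [evalPoly_eq_genPoly, ← genPoly_listCoboundary s hs hs2 n (isNormalized_extendList ha)]
  refine genPoly_congr s fun l hl => ?_
  obtain ⟨u, rfl⟩ := exists_eq_ofFn l hl
  rw [extendList_ofFn, coboundaryFun_extendList]

/-- The map induced by `evalPoly` on cohomology. -/
noncomputable def cohomologyPoly (s : Fin r → G) (hs : ∀ i j, s i * s j = s j * s i)
    (hs2 : ∀ i, s i * s i = 1) (n : ℕ) :
    Cohomology G n →ₗ[ZMod 2] MvPolynomial (Fin r) (ZMod 2) :=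
  Submodule.liftQ _ (evalPoly s n ∘ₗ (Cochain G n).subtype ∘ₗ (Cocycle G n).subtype) <| by
    intro a ha
    change evalPoly s n a.1.1 = 0
    have ha' : a.1 ∈ Boundary G n := ha
    cases n with
    | zero => rw [show a.1 = 0 from ha', Submodule.coe_zero, map_zero]
    | succ n =>
      obtain ⟨c, hc⟩ := ha'
      rw [← hc]
      exact evalPoly_coboundaryFun s hs hs2 c.2

theorem cohomologyPoly_cls (s : Fin r → G) (hs : ∀ i j, s i * s j = s j * s i)
    (hs2 : ∀ i, s i * s i = 1) {n : ℕ} (a : Cocycle G n) :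
    cohomologyPoly s hs hs2 n (cls a) = evalPoly s n a.1.1 := rfl

theorem cohomologyPoly_injective (s : Fin r → G) (hs : ∀ i j, s i * s j = s j * s i)
    (hs2 : ∀ i, s i * s i = 1) (χ : Fin r → G →* Multiplicative (ZMod 2))
    (hχ : ∀ i j, (χ i (s j)).toAdd = if i = j then 1 else 0)
    (hsep : ∀ g, (∀ i, χ i g = 1) → g = 1) (n : ℕ) :
    Function.Injective (cohomologyPoly s hs hs2 n) := by
  rw [injective_iff_map_eq_zero]
  intro x hx
  obtain ⟨a, rfl⟩ := cls_surjective x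
  rw [cohomologyPoly_cls, evalPoly_eq_genPoly] at hx
  rw [cls_eq_zero]
  obtain ⟨c, hc, hac⟩ := exists_eq_listCoboundary_of_genPoly_eq_zero s χ hχ hsep n
    (isNormalized_extendList a.1.2) (fun l hl => by
      obtain ⟨u, rfl⟩ := exists_eq_ofFn l hl
      rw [← coboundaryFun_extendList, mem_cocycle.1 a.2, Pi.zero_apply]) hx
  cases n with
  | zero =>
    refine Subtype.ext (funext fun u => ?_)
    rw [← extendList_ofFn a.1.1 u, hac _ List.length_ofFn, List.ofFn_zero]
    rfl
  | succ n =>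
    refine ⟨⟨_, hc.mem_cochain n⟩, Subtype.ext (funext fun u => ?_)⟩
    rw [← extendList_ofFn a.1.1 u, hac _ List.length_ofFn, ← coboundaryFun_ofFn]
    rfl

/-- The homomorphism of algebras from the cohomology to the polynomials given by `evalPoly`. -/
noncomputable def polyAlgHom (s : Fin r → G) (hs : ∀ i j, s i * s j = s j * s i)
    (hs2 : ∀ i, s i * s i = 1) :
    CohomologyAlgebra G →ₐ[ZMod 2] MvPolynomial (Fin r) (ZMod 2) :=
  DirectSum.toAlgebra (ZMod 2) (Cohomology G) (cohomologyPoly s hs hs2)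
    (by
      change evalPoly s 0 (constCocycle G 1).1.1 = 1
      simp [evalPoly_apply, constCocycle])
    (by
      intro m n x y
      obtain ⟨a, rfl⟩ := cls_surjective x
      obtain ⟨b, rfl⟩ := cls_surjective y
      exact evalPoly_cupFun s a.1.1 b.1.1)

theorem polyAlgHom_of (s : Fin r → G) (hs : ∀ i j, s i * s j = s j * s i)
    (hs2 : ∀ i, s i * s i = 1) (n : ℕ) (x : Cohomology G n) :
    polyAlgHom s hs hs2 (DirectSum.of _ n x) = cohomologyPoly s hs hs2 n x := by
  change DirectSum.toModule (ZMod 2) ℕ _ (cohomologyPoly s hs hs2)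
    (DirectSum.lof (ZMod 2) ℕ (Cohomology G) n x) = _
  exact DirectSum.toModule_lof _ _ _

theorem polyAlgHom_totalClass (s : Fin r → G) (hs : ∀ i j, s i * s j = s j * s i)
    (hs2 : ∀ i, s i * s i = 1) {n : ℕ} (a : Cocycle G n) :
    polyAlgHom s hs hs2 (totalClass a) =
      ∑ i : Fin n → Fin r, a.1.1 (fun j => s (i j)) • ∏ j, X (i j) :=
  polyAlgHom_of s hs hs2 n (cls a)

/-- The homomorphism is graded, so each homogeneous component of the image depends on one component
of the class, and injectivity in each degree suffices. -/
theorem polyAlgHom_injective (s : Fin r → G) (hs : ∀ i j, s i * s j = s j * s i)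
    (hs2 : ∀ i, s i * s i = 1) (χ : Fin r → G →* Multiplicative (ZMod 2))
    (hχ : ∀ i j, (χ i (s j)).toAdd = if i = j then 1 else 0)
    (hsep : ∀ g, (∀ i, χ i g = 1) → g = 1) :
    Function.Injective (polyAlgHom s hs hs2) := by
  classical
  rw [injective_iff_map_eq_zero]
  intro x hx
  have hhom : ∀ n (y : Cohomology G n), (cohomologyPoly s hs hs2 n y).IsHomogeneous n := by
    intro n y
    obtain ⟨a, rfl⟩ := cls_surjective y
    exact evalPoly_isHomogeneous s n a.1.1
  have hcomp : ∀ n (y : CohomologyAlgebra G), homogeneousComponent n (polyAlgHom s hs hs2 y) =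
      cohomologyPoly s hs hs2 n (y n) := by
    intro n y
    induction y using DirectSum.induction_on with
    | zero => simp
    | of m y =>
      rw [polyAlgHom_of]
      by_cases h : m = n
      · subst h
        rw [DirectSum.of_eq_same, homogeneousComponent_of_mem (hhom m y), if_pos rfl]
      · rw [DirectSum.of_eq_of_ne _ _ _ (Ne.symm h), homogeneousComponent_of_mem (hhom m y),
          if_neg (Ne.symm h), map_zero]
    | add y z hy hz => rw [map_add, map_add, hy, hz, DFinsupp.add_apply, map_add]
  refine DFinsupp.ext fun n => cohomologyPoly_injective s hs hs2 χ hχ hsep n ?_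
  rw [← hcomp, hx, map_zero, DFinsupp.zero_apply, map_zero]

end Polynomial

end NormalizedCohomology

/-! ### The isomorphism. -/

open NormalizedCohomology in
theorem corollary2p8 {G : Type*} [CommGroup G] [Module (ZMod 2) (Additive G)] {r : ℕ}
    (s : Module.Basis (Fin r) (ZMod 2) (Additive G)) :
    ∃ τ : MvPolynomial (Fin r) (ZMod 2) ≃ₐ[ZMod 2] CohomologyAlgebra G,
      (∀ (n : ℕ) (i : Fin n → Fin r),
        τ (∏ j, MvPolynomial.X (i j)) =
          (List.ofFn fun j => totalClass (homCocycle (s.coord (i j)).toAddMonoidHom)).prod) ∧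
      ∀ (n : ℕ) (a : Cocycle G n),
        τ.symm (totalClass a) =
          ∑ i : Fin n → Fin r,
            a.1.1 (fun j => (s (i j)).toMul) • ∏ j, MvPolynomial.X (i j) := by
  let σ : Fin r → G := fun i => (s i).toMul
  let χ : Fin r → G →* Multiplicative (ZMod 2) := fun i =>
    AddMonoidHom.toMultiplicativeRight (s.coord i).toAddMonoidHom
  have hσ : ∀ i j, σ i * σ j = σ j * σ i := fun i j => mul_comm _ _
  have hσ2 : ∀ i, σ i * σ i = 1 := fun i => by
    have h : s i + s i = 0 := by
      rw [← two_smul (ZMod 2), show (2 : ZMod 2) = 0 from rfl, zero_smul]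
    exact h
  have hχ : ∀ i j, (χ i (σ j)).toAdd = if i = j then 1 else 0 := fun i j => by
    change s.coord i (s j) = _
    rw [s.coord_apply, s.repr_self, Finsupp.single_apply]
    simp only [eq_comm]
  have hsep : ∀ g, (∀ i, χ i g = 1) → g = 1 := fun g hg =>
    (s.forall_coord_eq_zero_iff (x := Additive.ofMul g)).1 hg
  let φ := polyAlgHom σ hσ hσ2
  have hX : ∀ i, φ (totalClass (homCocycle (s.coord i).toAddMonoidHom)) = MvPolynomial.X i := by
    intro i
    rw [polyAlgHom_totalClass, ← (Equiv.funUnique (Fin 1) (Fin r)).symm.sum_comp,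
      Finset.sum_eq_single i]
    · have h : s.coord i (s i) = 1 := by simp
      change s.coord i (s i) • _ = _
      simp [h]
    · intro j _ hj
      have h : s.coord i (s j) = 0 := by simp [hj]
      change s.coord i (s j) • _ = _
      rw [h, zero_smul]
    · simp
  have hsurj : Function.Surjective φ := by
    -- The range is a subalgebra, so it is enough that it contains the variables.
    rw [← AlgHom.range_eq_top, ← top_le_iff, ← MvPolynomial.adjoin_range_X, Algebra.adjoin_le_iff]
    rintro _ ⟨i, rfl⟩
    exact ⟨_, hX i⟩
  let e := AlgEquiv.ofBijective φ ⟨polyAlgHom_injective σ hσ hσ2 χ hχ hsep, hsurj⟩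
  -- As `τ` is the inverse of `φ`, the formula for its inverse is that of `φ` on classes; the
  -- formula on monomials is checked after applying `φ`.
  refine ⟨e.symm, fun n i => ?_, fun n a => polyAlgHom_totalClass σ hσ hσ2 a⟩
  rw [AlgEquiv.symm_apply_eq]
  change _ = φ _
  rw [map_list_prod, List.map_ofFn, List.prod_ofFn]
  exact Finset.prod_congr rfl fun j _ => (hX (i j)).symm
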